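/- **Setting.** A generalized problem $\mathcal{Q}$ is a collection of classical planning instances $P=\langle V,I,G,A\rangle$ ($V$: finitely many variables with finite domains; $I$ fixes the initial state $s_0$; $G$ is a set of literals; $A(s)$ is the set of actions applicable in a state $s$, and $f(a,s)$ the successor state). $F$ is a finite set of features: boolean features $p$ and numerical features $n$ with values $\phi_p(s)\in\{\text{true},\text{false}\}$, $\phi_n(s)\ge 0$ on the reachable states of the instances. The abstract state $\bar s$ is the truth valuation of the atoms $p$ and $n=0$ at $s$. An abstract action $\bar a=\langle \mathit{Pre};\mathit{Eff}\rangle$ has preconditions $p,\neg p,n=0,n>0$ and effects $p,\neg p,n{\uparrow},n{\downarrow}$; a boolean literal may be an effect only if its complement is a precondition. An action $a\in A(s)$ *instantiates* $\bar a$ in $s$ if $\mathit{Pre}$ is true in $\bar s$ and, with $s'=f(a,s)$: $p\in\mathit{Eff}$ and $\neg p\in\mathit{Pre}$ iff $p$ becomes true; $\neg p\in\mathit{Eff}$ and $p\in\mathit{Pre}$ iff $p$ becomes false; $n{\uparrow}\in\mathit{Eff}$ iff $\phi_n(s')>\phi_n(s)$; $n{\downarrow}\in\mathit{Eff}$ iff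 $\phi_n(s')<\phi_n(s)$. A set $A_F$ of abstract actions is *sound relative to $\mathcal{Q}$* if whenever $\bar a\in A_F$ is applicable in $\bar s$, $s$ a reachable state of an instance $P\in\mathcal{Q}$, some action of $P$ instantiates $\bar a$ in $s$. A *sample* $\mathcal{S}$ is a non-empty set of transitions $(s,s')$ from reachable states $s$ of instances of $\mathcal{Q}$, which contains with $(s,s')$ all transitions from $s$; $A_F$ is *sound relative to $\mathcal{S}$* if for every $\bar a\in A_F$ applicable in $\bar s$, where $s$ is a first component of a pair in $\mathcal{S}$, there is $(s,s')\in\mathcal{S}$ with the same qualitative effects as $\bar a$. **Abstract problems.** Let $I_F,G_F$ be formulas over the atoms $p$, $n=0$, and $Q_F=\langle V_F,I_F,G_F,A_F\rangle$. The fully observable non-deterministic (FOND) problem $Q'_F$ has these atoms as its variables, the initial states satisfying $I_F$, the goal $G_F$, and the actions $A_F$ with $n{\uparrow}$ replaced by $n>0$ and $n{\downarrow}$ by the non-deterministic effect $n>0\,|\,n=0$. The FOND problem $Q^+_F$ (with counter capacity $K\in\mathbb{N}$) adds a stack of distinct numerical variables, initially empty, and for each depth $d\le|N|$ of the stack, where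 $N$ is the set of numerical features, a counter $c_d\in\{0,\dots,K\}$, initially $0$. Its actions are: push $n$ (if $n$ is not on the stack and $c_d<K$ for the present depth $d$; it increments $c_d$ and resets $c_{d+1}$ to $0$); pop (if the stack is not empty); and the actions $\bar a\in A_F$, applicable only if $\bar a$ increments no variable on the stack and, if $\bar a$ decrements some variable, charged to a variable $n$ on the stack with $n{\downarrow}\in\mathit{Eff}$, resetting the counters $c_{d}$ with $d\ge l$, where $l$ is the level of $n$ in the stack (bottom $=1$). A policy (a partial map from states to actions) *solves* a FOND problem if it is a strong cyclic solution: from every state that it may lead to from an initial state, it can reach a goal state. A policy $\pi$ for $Q^+_F$ is run in an instance $P$ by reading the atoms $p$ and $n=0$ off the current state through the features and keeping the stack and the counters as memory; when $\pi$ selects $\bar a$, any action of $P$ that instantiates $\bar a$ in the current state may be applied. A policy $\rho$ mapping abstract states to abstract actions is run in the same way without memory. A policy solves $P$ if all its maximal trajectories from $s_0$ in $P$, finite or infinite, reach a goal state of $P$. **Theorem 5.** Suppose that the abstract actions $A_F$, which are sound relative to a sample $\mathcal{S}$ for $\mathcal{Q}$, are in fact sound relative to $\mathcal{Q}$. Then,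 for every $K$, any policy $\pi$ that solves $Q^+_F$ solves every instance $P=\langle V,I,G,A\rangle$ of $\mathcal{Q}$ with $I\models I_F$ (that is, $\bar s_0$ satisfies $I_F$) and $G_F\models G$ (every reachable state $s$ of $P$ such that $\bar s$ satisfies $G_F$ satisfies $G$). Moreover, if the abstract action selected by $\pi$ in the non-goal states of $Q^+_F$ that it may lead to is always $\rho(\bar s)$, for a policy $\rho$ over the abstract states $\bar s$ alone, then $\rho$ solves every such $P$ too. -/

import Mathlib

open scoped NNReal

universe u v w

namespace GenPlan

/-! ### Classical planning instances -/

/-- A classical planning instance `P = ⟨V, I, G, A⟩` over finitely many state variables with finite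
domains. `init` lists the atoms `x = init x` of `I`; `goal` is the set of literals of `G`, where
`(⟨x, c⟩, true)` is the literal `x = c` and `(⟨x, c⟩, false)` is `x ≠ c`. The language of the
actions is left open: what matters is which actions are applicable in which state, and the
successor function. -/
structure Instance where
  Var : Type u
  Val : Var → Type u
  finite_var : Finite Var
  finite_val : ∀ x, Finite (Val x)
  init : ∀ x, Val x
  goal : Set ((Σ x, Val x) × Bool)
  Act : Type u
  applicable : Act → (∀ x, Val x) → Prop
  next : Act → (∀ x, Val x) → (∀ x, Val x)

/-- A state is a valuation of the state variables. -/
abbrev Instance.State (P : Instance.{u}) : Type u := ∀ x, P.Val x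

/-- `s` makes all literals of `G` true. -/
def Instance.IsGoal (P : Instance.{u}) (s : P.State) : Prop :=
  ∀ l ∈ P.goal, (s l.1.1 = l.1.2 ↔ l.2 = true)

/-- `s'` is a successor of `s`: `s' = f(a, s)` for some `a ∈ A(s)`. -/
def Instance.Succ (P : Instance.{u}) (s s' : P.State) : Prop :=
  ∃ a, P.applicable a s ∧ s' = P.next a s

/-- `s` is reachable from the initial state by an applicable action sequence. -/
def Instance.Reachable (P : Instance.{u}) (s : P.State) : Prop :=
  Relation.ReflTransGen P.Succ P.init s

/-! ### Features, abstract states, abstract actions -/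

/-- Boolean features (indexed by `B`) and non-negative numerical features (indexed by `N`).
Only the values at the reachable states of the instances under consideration are ever used. -/
structure Features (B : Type v) (N : Type w) where
  bool : B → (P : Instance.{u}) → P.State → Bool
  num : N → (P : Instance.{u}) → P.State → ℝ≥0

/-- A truth valuation of the atoms `p` (`p : B`) and `n = 0` (`n : N`). -/
@[ext] structure AbsState (B : Type v) (N : Type w) where
  bool : B → Bool
  zero : N → Bool

open Classical in
/-- The abstract state that corresponds to the state `s` of the instance `P`. -/
noncomputable def Features.abs {B : Type v} {N : Type w} (φ : Features.{u} B N)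
    (P : Instance.{u}) (s : P.State) : AbsState B N where
  bool p := φ.bool p P s
  zero n := decide (φ.num n P s = 0)

/-- Propositional formulas over the atoms `p` and `n = 0`. -/
inductive Formula (B : Type v) (N : Type w) where
  | verum : Formula B N
  | bool (p : B) : Formula B N
  | zero (n : N) : Formula B N
  | neg (A : Formula B N) : Formula B N
  | and (A A' : Formula B N) : Formula B N

/-- Truth of a formula in an abstract state. -/
def AbsState.Sat {B : Type v} {N : Type w} (x : AbsState B N) : Formula B N → Prop
  | .verum => True
  | .bool p => x.bool p = true
  | .zero n => x.zero n = true
  | .neg A => ¬ x.Sat A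
  | .and A A' => x.Sat A ∧ x.Sat A'

/-- Qualitative numerical effects: increment and decrement. -/
inductive Change where
  | inc
  | dec

/-- An abstract action `⟨Pre; Eff⟩`. `preB p = some true` (`some false`) stands for `p ∈ Pre`
(`¬p ∈ Pre`), `preN n = some true` (`some false`) for `n = 0 ∈ Pre` (`n > 0 ∈ Pre`),
`effB p = some true` (`some false`) for `p ∈ Eff` (`¬p ∈ Eff`), and
`effN n = some .inc` (`some .dec`) for `n↑ ∈ Eff` (`n↓ ∈ Eff`). -/
structure AbsAction (B : Type v) (N : Type w) where
  preB : B → Option Bool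
  preN : N → Option Bool
  effB : B → Option Bool
  effN : N → Option Change

/-- The preconditions of `a` are true in `x`. -/
def AbsAction.Applicable {B : Type v} {N : Type w} (a : AbsAction B N) (x : AbsState B N) : Prop :=
  (∀ p b, a.preB p = some b → x.bool p = b) ∧ (∀ n b, a.preN n = some b → x.zero n = b)

/-- A literal is an effect only where its complement is a precondition (the convention for
abstract actions that the definition of "same qualitative effects" presupposes). -/
def AbsAction.Guarded {B : Type v} {N : Type w} (a : AbsAction B N) : Prop :=
  ∀ p b, a.effB p = some b → a.preB p = some (!b)

/-- The transition `(s, s')` changes the features exactly as the abstract action `a` says, and `a`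
is applicable in `s`. -/
def SameEffects {B : Type v} {N : Type w} (φ : Features.{u} B N) (P : Instance.{u})
    (s s' : P.State) (a : AbsAction B N) : Prop :=
  a.Applicable (φ.abs P s) ∧
  (∀ p, (a.effB p = some true ∧ a.preB p = some false) ↔
    (φ.bool p P s = false ∧ φ.bool p P s' = true)) ∧
  (∀ p, (a.effB p = some false ∧ a.preB p = some true) ↔
    (φ.bool p P s = true ∧ φ.bool p P s' = false)) ∧
  (∀ n, a.effN n = some .inc ↔ φ.num n P s < φ.num n P s') ∧
  (∀ n, a.effN n = some .dec ↔ φ.num n P s' < φ.num n P s)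

/-- The action `c` of `P` instantiates the abstract action `a` in the state `s`. -/
def Instantiates {B : Type v} {N : Type w} (φ : Features.{u} B N) (P : Instance.{u})
    (s : P.State) (c : P.Act) (a : AbsAction B N) : Prop :=
  P.applicable c s ∧ SameEffects φ P s (P.next c s) a

/-- Soundness of a set of abstract actions relative to a generalized problem. -/
def Sound {B : Type v} {N : Type w} (𝓠 : Set Instance.{u}) (φ : Features.{u} B N)
    (A : Set (AbsAction B N)) : Prop :=
  ∀ P ∈ 𝓠, ∀ s : P.State, P.Reachable s → ∀ a ∈ A, a.Applicable (φ.abs P s) →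
    ∃ c : P.Act, Instantiates φ P s c a

/-- Tagged transitions `(s, s', P)`. -/
abbrev Transition : Type (u + 1) := Σ P : Instance.{u}, P.State × P.State

/-- `S` is a sample set for the generalized problem `𝓠`. -/
structure IsSample (𝓠 : Set Instance.{u}) (S : Set Transition.{u}) : Prop where
  nonempty : S.Nonempty
  mem : ∀ t ∈ S, t.1 ∈ 𝓠
  reachable : ∀ t ∈ S, t.1.Reachable t.2.1
  succ : ∀ t ∈ S, t.1.Succ t.2.1 t.2.2
  closed : ∀ (P : Instance.{u}) (s s' s'' : P.State),
    (⟨P, s, s'⟩ : Transition) ∈ S → P.Succ s s'' → (⟨P, s, s''⟩ : Transition) ∈ S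

/-- Soundness of a set of abstract actions relative to a sample set. -/
def SoundOnSample {B : Type v} {N : Type w} (S : Set Transition.{u}) (φ : Features.{u} B N)
    (A : Set (AbsAction B N)) : Prop :=
  ∀ (P : Instance.{u}) (s : P.State), (∃ s', (⟨P, s, s'⟩ : Transition) ∈ S) →
    ∀ a ∈ A, a.Applicable (φ.abs P s) →
      ∃ s', (⟨P, s, s'⟩ : Transition) ∈ S ∧ SameEffects φ P s s' a

/-! ### FOND problems and strong cyclic solutions -/

/-- A fully observable non-deterministic planning problem. -/
structure FOND (X : Type v) (Act : Type w) where
  init : Set X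
  goal : Set X
  applicable : Act → X → Prop
  outcomes : Act → X → Set X

/-- One step of the execution of the policy `π`; the execution stops at goal states. -/
def FOND.Step {X : Type v} {Act : Type w} (D : FOND X Act) (π : X → Option Act) (x y : X) : Prop :=
  x ∉ D.goal ∧ ∃ a, π x = some a ∧ D.applicable a x ∧ y ∈ D.outcomes a x

/-- `x` is reachable from an initial state when `π` is executed. -/
def FOND.PolicyReachable {X : Type v} {Act : Type w} (D : FOND X Act) (π : X → Option Act)
    (x : X) : Prop :=
  ∃ x₀ ∈ D.init, Relation.ReflTransGen (D.Step π) x₀ x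

/-- `π` is a (strong cyclic) solution: from every state that `π` may lead to, `π` can reach the
goal. -/
def FOND.Solves {X : Type v} {Act : Type w} (D : FOND X Act) (π : X → Option Act) : Prop :=
  ∀ x, D.PolicyReachable π x → ∃ y ∈ D.goal, Relation.ReflTransGen (D.Step π) x y

/-! ### The abstraction `Q_F`, the FOND problem `Q'_F`, and the FOND problem `Q⁺_F` -/

/-- The abstraction `Q_F = ⟨V_F, I_F, G_F, A_F⟩`, a qualitative numerical problem. -/
structure QNP (B : Type v) (N : Type w) where
  init : Formula B N
  goal : Formula B N
  actions : Set (AbsAction B N)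

/-- The boolean FOND problem `Q'_F`: increments of `n` make `n > 0` true, decrements of `n` have
the non-deterministic effect `n > 0 | n = 0`. -/
def QNP.toFOND {B : Type v} {N : Type w} (Q : QNP B N) : FOND (AbsState B N) (AbsAction B N) where
  init := {x | x.Sat Q.init}
  goal := {x | x.Sat Q.goal}
  applicable a x := a ∈ Q.actions ∧ a.Applicable x
  outcomes a x := {y |
    (∀ p b, a.effB p = some b → y.bool p = b) ∧
    (∀ p, a.effB p = none → y.bool p = x.bool p) ∧
    (∀ n, a.effN n = some .inc → y.zero n = false) ∧
    (∀ n, a.effN n = none → y.zero n = x.zero n)}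

/-- The additional variables of `Q⁺_F`: a stack (listed from bottom to top) of distinct numerical
variables, and for each stack depth `d ≤ |N|` a counter with values `0, …, K`. -/
structure Memory (N : Type w) [Fintype N] (K : ℕ) where
  stack : List N
  nodup : stack.Nodup
  count : Fin (Fintype.card N + 1) → Fin (K + 1)

/-- The empty stack, with all counters zero. -/
def Memory.empty (N : Type w) [Fintype N] (K : ℕ) : Memory N K where
  stack := []
  nodup := List.nodup_nil
  count _ := 0

/-- The actions of `Q⁺_F`. `apply a none` is the version of an abstract action `a` without
decrements, `apply a (some n)` the version of an abstract action `a` with the effect `n↓` that is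
charged to the variable `n` on the stack. -/
inductive PlusAction (B : Type v) (N : Type w) where
  | push (n : N) : PlusAction B N
  | pop : PlusAction B N
  | apply (a : AbsAction B N) (charge : Option N) : PlusAction B N

/-- Applicability in `Q⁺_F`, as far as it depends on the additional variables: a variable can be
pushed if it is not on the stack and the counter of the present depth is below `K`; a variable on
the stack cannot be incremented; an action that decrements variables must be charged to one of them
that is on the stack. -/
def PlusAction.Allowed {B : Type v} {N : Type w} [Fintype N] {K : ℕ} :
    PlusAction B N → Memory N K → Prop
  | .push n, m => n ∉ m.stack ∧
      ∀ d : Fin (Fintype.card N + 1), (d : ℕ) = m.stack.length → (m.count d : ℕ) < K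
  | .pop, m => m.stack ≠ []
  | .apply a none, m => (∀ n, a.effN n = some .inc → n ∉ m.stack) ∧ ∀ n, a.effN n ≠ some .dec
  | .apply a (some k), m => (∀ n, a.effN n = some .inc → n ∉ m.stack) ∧
      a.effN k = some .dec ∧ k ∈ m.stack

/-- The (deterministic) effect on the additional variables. Pushing at depth `d` increments the
counter of depth `d` and resets the one of depth `d + 1`. A decrement charged to the variable at
the level `l` of the stack (the bottom has level `1`) resets the counters of all depths `d ≥ l`. -/
def PlusAction.Update {B : Type v} {N : Type w} [Fintype N] [DecidableEq N] {K : ℕ} :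
    PlusAction B N → Memory N K → Memory N K → Prop
  | .push n, m, m' => m'.stack = m.stack ++ [n] ∧
      ∀ d : Fin (Fintype.card N + 1), (m'.count d : ℕ) =
        if (d : ℕ) = m.stack.length then (m.count d : ℕ) + 1
        else if (d : ℕ) = m.stack.length + 1 then 0 else (m.count d : ℕ)
  | .pop, m, m' => m'.stack = m.stack.dropLast ∧ m'.count = m.count
  | .apply _ none, m, m' => m' = m
  | .apply _ (some k), m, m' => m'.stack = m.stack ∧
      ∀ d : Fin (Fintype.card N + 1), m'.count d =
        if m.stack.idxOf k + 1 ≤ (d : ℕ) then 0 else m.count d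

/-- The FOND problem `Q⁺_F` with counter capacity `K`: the FOND problem `Q'_F` amended with the
stack and the counters. -/
def QNP.plus {B : Type v} {N : Type w} [Fintype N] [DecidableEq N] (Q : QNP B N) (K : ℕ) :
    FOND (AbsState B N × Memory N K) (PlusAction B N) where
  init := {c | c.1 ∈ Q.toFOND.init ∧ c.2 = Memory.empty N K}
  goal := {c | c.1 ∈ Q.toFOND.goal}
  applicable α c := α.Allowed c.2 ∧
    match α with
    | .apply a _ => Q.toFOND.applicable a c.1
    | _ => True
  outcomes α c := {c' | α.Update c.2 c'.2 ∧
    match α with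
    | .apply a _ => c'.1 ∈ Q.toFOND.outcomes a c.1
    | _ => c'.1 = c.1}

/-! ### Policies at work in an instance -/

/-- All maximal executions of the step relation `R` that start in `c₀`, infinite or finite, reach
a configuration with the property `T`. -/
def AllReach {C : Type v} (R : C → C → Prop) (T : C → Prop) (c₀ : C) : Prop :=
  (∀ t : ℕ → C, t 0 = c₀ → (∀ i, R (t i) (t (i + 1))) → ∃ i, T (t i)) ∧
  (∀ (k : ℕ) (t : ℕ → C), t 0 = c₀ → (∀ i < k, R (t i) (t (i + 1))) → (∀ c, ¬ R (t k) c) →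
    ∃ i ≤ k, T (t i))

/-- One step of a policy `π` from abstract states to abstract actions in the instance `P`: an action
of `P` that instantiates `π(s̄)` in `s` is applied. -/
def PolicyStep {B : Type v} {N : Type w} (φ : Features.{u} B N) (P : Instance.{u})
    (π : AbsState B N → Option (AbsAction B N)) (s s' : P.State) : Prop :=
  ∃ a c, π (φ.abs P s) = some a ∧ Instantiates φ P s c a ∧ s' = P.next c s

/-- The policy `π` from abstract states to abstract actions solves `P`. -/
def PolicySolves {B : Type v} {N : Type w} (φ : Features.{u} B N) (P : Instance.{u})
    (π : AbsState B N → Option (AbsAction B N)) : Prop :=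
  AllReach (PolicyStep φ P π) P.IsGoal P.init

/-- One step of a policy for `Q⁺_F` in the instance `P`: the truth values of the atoms `p` and
`n = 0` are read off the state of `P` through the features, and the additional variables of `Q⁺_F`
are kept as a memory. A push or pop changes the memory only; for a version of an abstract action
`a`, an action of `P` that instantiates `a` is applied. -/
def PlusStep {B : Type v} {N : Type w} [Fintype N] [DecidableEq N] {K : ℕ}
    (φ : Features.{u} B N) (P : Instance.{u})
    (π : AbsState B N × Memory N K → Option (PlusAction B N))
    (c c' : P.State × Memory N K) : Prop :=
  ∃ α, π (φ.abs P c.1, c.2) = some α ∧ α.Allowed c.2 ∧ α.Update c.2 c'.2 ∧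
    match α with
    | .apply a _ => ∃ e, Instantiates φ P c.1 e a ∧ c'.1 = P.next e c.1
    | _ => c'.1 = c.1

/-- The policy `π` for `Q⁺_F` solves `P`. -/
def PlusSolves {B : Type v} {N : Type w} [Fintype N] [DecidableEq N] {K : ℕ}
    (φ : Features.{u} B N) (P : Instance.{u})
    (π : AbsState B N × Memory N K → Option (PlusAction B N)) : Prop :=
  AllReach (PlusStep φ P π) (fun c => P.IsGoal c.1) (P.init, Memory.empty N K)

/-- The policy `π` for `Q⁺_F` selects abstract actions as the policy `ρ` over the abstract states
does, wherever `π` may lead: the choice of the abstract action depends on the features only. -/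
def QNP.Projects {B : Type v} {N : Type w} [Fintype N] [DecidableEq N] {K : ℕ} (Q : QNP B N)
    (π : AbsState B N × Memory N K → Option (PlusAction B N))
    (ρ : AbsState B N → Option (AbsAction B N)) : Prop :=
  ∀ c, (Q.plus K).PolicyReachable π c → c ∉ (Q.plus K).goal →
    ∀ a k, π c = some (.apply a k) → ρ c.1 = some a

end GenPlan

/-! By soundness and the fact that `π` solves `Q⁺_F`, an execution in `P` cannot get stuck before
the goal; the point is termination. Let `d` be the limit inferior of the stack depth along an
infinite execution. Eventually the `d` bottom variables are fixed. They are never incremented, and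
`P` has finitely many states, so their values become constant. From then on `c_d` cannot fall: its
resets need a push at depth `d - 1` or a decrement charged to a bottom variable. Being bounded by
`K`, it becomes constant too. At a later time with depth exactly `d`, a push would raise `c_d`, a
pop would fall below `d`, and a charged decrement would change a bottom variable. Only actions
without decrements remain; they leave the memory alone, so this situation persists
(`eventually_apply_none`).

Such actions are deterministic in `Q⁺_F`. Hence the path to the goal that a strong cyclic solution
guarantees must be the execution itself (`not_forall_live`).

For `ρ`, each step is simulated by finitely many pushes and pops of `π` followed by the same
abstract action; well-foundedness of the steps of `π` carries over. -/

namespace GenPlan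

/-! ### Stabilization of sequences -/

section Sequences

/-- The least value on the monotone tail is attained, and nothing after that can go lower. This
serves both feature values and, in the dual order, counters. -/
theorem eventually_succ_eq_of_finite_range {α : Type*} [LinearOrder α] (f : ℕ → α)
    (hfin : (Set.range f).Finite) (hf : ∀ᶠ i in Filter.atTop, f (i + 1) ≤ f i) :
    ∀ᶠ i in Filter.atTop, f (i + 1) = f i := by
  obtain ⟨T, hT⟩ := Filter.eventually_atTop.1 hf
  have hmono : ∀ i, T ≤ i → ∀ j, i ≤ j → f j ≤ f i := by
    intro i hi j hij
    induction j, hij using Nat.le_induction with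
    | base => exact le_rfl
    | succ j hij ih => exact (hT j (hi.trans hij)).trans ih
  obtain ⟨m, hm, hmin⟩ := Set.exists_min_image (f '' Set.Ici T) id
    (hfin.subset (Set.image_subset_range _ _)) ⟨f T, T, Set.self_mem_Ici, rfl⟩
  obtain ⟨k, hk, rfl⟩ := hm
  have hconst : ∀ j, k ≤ j → f j = f k := fun j hj =>
    le_antisymm (hmono k hk j hj) (hmin _ ⟨j, le_trans hk hj, rfl⟩)
  exact Filter.eventually_atTop.2
    ⟨k, fun j hj => (hconst (j + 1) (by omega)).trans (hconst j hj).symm⟩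

/-- A bounded sequence of natural numbers has a limit inferior. -/
theorem exists_liminf_nat (f : ℕ → ℕ) (b : ℕ) (hb : ∀ i, f i ≤ b) :
    ∃ d, (∀ᶠ i in Filter.atTop, d ≤ f i) ∧ ∃ᶠ i in Filter.atTop, f i = d := by
  classical
  have hex : ∃ d, ¬ ∀ᶠ i in Filter.atTop, d ≤ f i := by
    refine ⟨b + 1, fun h => ?_⟩
    obtain ⟨i, hi⟩ := h.exists
    have := hb i
    omega
  -- The least bound that fails infinitely often is positive, since `0` never fails; its predecessor
  -- is the limit inferior.
  obtain ⟨d, hd⟩ : ∃ d, Nat.find hex = d + 1 := by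
    refine Nat.exists_eq_succ_of_ne_zero fun h => ?_
    have := Nat.find_spec hex
    rw [h] at this
    exact this (Filter.Eventually.of_forall fun i => Nat.zero_le _)
  have h1 : ∀ᶠ i in Filter.atTop, d ≤ f i := by
    by_contra h
    have := Nat.find_min' hex h
    omega
  have h2 := Nat.find_spec hex
  rw [hd] at h2
  refine ⟨d, h1, ?_⟩
  have h3 := Filter.not_eventually.1 h2
  exact (h3.and_eventually h1).mono fun i hi => by omega

end Sequences

/-! ### Concrete transitions and FOND outcomes -/

variable {B : Type v} {N : Type w}

/-- Transitions that agree with `a` are among the outcomes of `a` in the FOND abstraction. -/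
theorem SameEffects.mem_outcomes {φ : Features.{u} B N} {P : Instance.{u}} {s s' : P.State}
    {a : AbsAction B N} (h : SameEffects φ P s s' a) (ha : a.Guarded) (Q : QNP B N) :
    φ.abs P s' ∈ Q.toFOND.outcomes a (φ.abs P s) := by
  obtain ⟨-, hpos, hneg, hinc, hdec⟩ := h
  refine ⟨fun p b hp => ?_, fun p hp => ?_, fun n hn => ?_, fun n hn => ?_⟩
  · have hpre := ha p b hp
    cases b
    · exact ((hneg p).1 ⟨hp, hpre⟩).2
    · exact ((hpos p).1 ⟨hp, hpre⟩).2
  · have h1 := hpos p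
    have h2 := hneg p
    rw [hp] at h1 h2
    change φ.bool p P s' = φ.bool p P s
    cases hs : φ.bool p P s <;> cases hs' : φ.bool p P s' <;> simp_all
  · have h1 := (hinc n).1 hn
    have h2 : φ.num n P s' ≠ 0 := (lt_of_le_of_lt zero_le h1).ne'
    simp [Features.abs, h2]
  · have h1 := hinc n
    have h2 := hdec n
    rw [hn] at h1 h2
    have h3 : φ.num n P s' = φ.num n P s :=
      le_antisymm (not_lt.1 fun h => by cases h1.2 h) (not_lt.1 fun h => by cases h2.2 h)
    simp [Features.abs, h3]

/-- Without decrements, abstract actions are deterministic in the FOND abstraction. -/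
theorem QNP.outcomes_unique {Q : QNP B N} {a : AbsAction B N} {x y z : AbsState B N}
    (ha : ∀ n, a.effN n ≠ some .dec) (hy : y ∈ Q.toFOND.outcomes a x)
    (hz : z ∈ Q.toFOND.outcomes a x) : y = z := by
  obtain ⟨y1, y2, y3, y4⟩ := hy
  obtain ⟨z1, z2, z3, z4⟩ := hz
  ext i
  · cases h : a.effB i with
    | none => rw [y2 i h, z2 i h]
    | some b => rw [y1 i b h, z1 i b h]
  · cases h : a.effN i with
    | none => rw [y4 i h, z4 i h]
    | some c =>
      cases c with
      | inc => rw [y3 i h, z3 i h]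
      | dec => exact absurd h (ha i)

variable [Fintype N] {K : ℕ}

theorem Memory.length_le (m : Memory N K) : m.stack.length ≤ Fintype.card N :=
  m.nodup.length_le_card

/-- A solution has a step at every non-goal state that it may lead to. -/
theorem FOND.Solves.exists_step {X : Type*} {Act : Type*} {D : FOND X Act} {π : X → Option Act}
    (h : D.Solves π) {x : X} (hx : D.PolicyReachable π x) (hg : x ∉ D.goal) :
    ∃ y, D.Step π x y := by
  obtain ⟨y, hy, hxy⟩ := h x hx
  rcases hxy.cases_head with rfl | ⟨z, hz, -⟩
  · exact absurd hy hg
  · exact ⟨z, hz⟩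

theorem FOND.PolicyReachable.step {X : Type*} {Act : Type*} {D : FOND X Act} {π : X → Option Act}
    {x y : X} (hx : D.PolicyReachable π x) (hxy : D.Step π x y) : D.PolicyReachable π y := by
  obtain ⟨x₀, h₀, h⟩ := hx
  exact ⟨x₀, h₀, h.tail hxy⟩

variable [DecidableEq N]

/-! ### Executions in an instance, seen in `Q⁺_F` -/

section Execution

variable {φ : Features.{u} B N} {P : Instance.{u}} {Q : QNP B N}
  {π : AbsState B N × Memory N K → Option (PlusAction B N)}

/-- The state of `Q⁺_F` that corresponds to a configuration of the execution in `P`. -/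
noncomputable def configAbs (φ : Features.{u} B N) (P : Instance.{u}) (c : P.State × Memory N K) :
    AbsState B N × Memory N K :=
  (φ.abs P c.1, c.2)

/-- A configuration over a reachable state of `P` whose abstraction is reachable in `Q⁺_F` and
which is not a goal of `Q⁺_F`. -/
def Live (φ : Features.{u} B N) (P : Instance.{u}) (Q : QNP B N)
    (π : AbsState B N × Memory N K → Option (PlusAction B N)) (c : P.State × Memory N K) : Prop :=
  P.Reachable c.1 ∧ (Q.plus K).PolicyReachable π (configAbs φ P c) ∧
    configAbs φ P c ∉ (Q.plus K).goal

/-- Steps in `P` from live configurations are steps of `Q⁺_F`. -/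
theorem PlusStep.toFOND {c c' : P.State × Memory N K} (hA : ∀ a ∈ Q.actions, a.Guarded)
    (hπ : (Q.plus K).Solves π) (hc : Live φ P Q π c) (h : PlusStep φ P π c c') :
    (Q.plus K).Step π (configAbs φ P c) (configAbs φ P c') := by
  obtain ⟨-, hreach, hgoal⟩ := hc
  -- A `PlusStep` does not record that the abstract action belongs to `A_F`; this comes from `π`
  -- being a solution.
  obtain ⟨y, -, α', hα', happ, -⟩ := hπ.exists_step hreach hgoal
  obtain ⟨α, hα, hallow, hupd, hs⟩ := h
  obtain rfl : α = α' := Option.some.inj (hα.symm.trans hα')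
  refine ⟨hgoal, α, hα, happ, hupd, ?_⟩
  cases α with
  | push n => exact congrArg (φ.abs P) hs
  | pop => exact congrArg (φ.abs P) hs
  | apply a k =>
    obtain ⟨e, he, hs⟩ := hs
    have := he.2.mem_outcomes (hA a happ.2.1) Q
    rw [← hs] at this
    exact this

theorem PlusStep.reachable {c c' : P.State × Memory N K} (hc : P.Reachable c.1)
    (h : PlusStep φ P π c c') : P.Reachable c'.1 := by
  obtain ⟨α, -, -, -, hs⟩ := h
  cases α with
  | push n => exact (show c'.1 = c.1 from hs) ▸ hc
  | pop => exact (show c'.1 = c.1 from hs) ▸ hc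
  | apply a k =>
    obtain ⟨e, he, hs⟩ := hs
    exact hc.tail ⟨e, he.1, hs⟩

/-- Since `G_F ⊨ G`, an execution that avoids the goals of `P` avoids those of `Q⁺_F`. -/
theorem Live.step {c c' : P.State × Memory N K} (hA : ∀ a ∈ Q.actions, a.Guarded)
    (hπ : (Q.plus K).Solves π)
    (hG : ∀ s : P.State, P.Reachable s → (φ.abs P s).Sat Q.goal → P.IsGoal s)
    (hc : Live φ P Q π c) (h : PlusStep φ P π c c') (hc' : ¬ P.IsGoal c'.1) :
    Live φ P Q π c' :=
  ⟨h.reachable hc.1, hc.2.1.step (h.toFOND hA hπ hc), fun hg => hc' (hG _ (h.reachable hc.1) hg)⟩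

/-- Live configurations have successors: the selected action is applicable, and if it is an
abstract action, it is instantiated by soundness. -/
theorem Live.exists_plusStep {c : P.State × Memory N K} (hπ : (Q.plus K).Solves π)
    (hsound : ∀ s : P.State, P.Reachable s → ∀ a ∈ Q.actions, a.Applicable (φ.abs P s) →
      ∃ e : P.Act, Instantiates φ P s e a)
    (hc : Live φ P Q π c) : ∃ c', PlusStep φ P π c c' := by
  obtain ⟨hr, hreach, hgoal⟩ := hc
  obtain ⟨y, -, α, hα, happ, hupd, hy⟩ := hπ.exists_step hreach hgoal
  cases α with
  | push n => exact ⟨(c.1, y.2), _, hα, happ.1, hupd, rfl⟩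
  | pop => exact ⟨(c.1, y.2), _, hα, happ.1, hupd, rfl⟩
  | apply a k =>
    obtain ⟨e, he⟩ := hsound c.1 hr a happ.2.1 happ.2.2
    exact ⟨(P.next e c.1, y.2), _, hα, happ.1, hupd, e, he, rfl⟩

/-- A step keeps the bottom of the stack as long as the depth does not fall below it. -/
theorem PlusStep.take_stack {c c' : P.State × Memory N K} (h : PlusStep φ P π c c') {d : ℕ}
    (hd : d ≤ c.2.stack.length) (hd' : d ≤ c'.2.stack.length) :
    c'.2.stack.take d = c.2.stack.take d := by
  obtain ⟨α, -, -, hupd, -⟩ := h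
  match α, hupd with
  | .push n, hupd => rw [hupd.1, List.take_append_of_le_length hd]
  | .pop, hupd =>
    rw [hupd.1] at hd' ⊢
    rw [List.length_dropLast] at hd'
    rw [List.dropLast_eq_take, List.take_take, min_eq_left hd']
  | .apply a none, hupd => rw [show c'.2 = c.2 from hupd]
  | .apply a (some k), hupd => rw [hupd.1]

/-- Variables on the stack are never incremented. -/
theorem PlusStep.num_le {c c' : P.State × Memory N K} (h : PlusStep φ P π c c') {n : N}
    (hn : n ∈ c.2.stack) : φ.num n P c'.1 ≤ φ.num n P c.1 := by
  obtain ⟨α, -, hallow, -, hs⟩ := h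
  match α, hallow, hs with
  | .push n, _, hs => exact le_of_eq (congrArg (φ.num _ P) hs)
  | .pop, _, hs => exact le_of_eq (congrArg (φ.num _ P) hs)
  | .apply a none, hallow, ⟨e, he, hs⟩ =>
    rw [hs]
    exact not_lt.1 fun hlt => hallow.1 n ((he.2.2.2.2.1 n).2 hlt) hn
  | .apply a (some k), hallow, ⟨e, he, hs⟩ =>
    rw [hs]
    exact not_lt.1 fun hlt => hallow.1 n ((he.2.2.2.2.1 n).2 hlt) hn

/-- If none of the `d` bottom variables of the stack changes, then the counter `c_d` does not
decrease. -/
theorem PlusStep.count_le {c c' : P.State × Memory N K} (h : PlusStep φ P π c c')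
    (d : Fin (Fintype.card N + 1)) (hd : (d : ℕ) ≤ c.2.stack.length)
    (hnum : ∀ n ∈ c.2.stack.take d, φ.num n P c'.1 = φ.num n P c.1) :
    c.2.count d ≤ c'.2.count d := by
  obtain ⟨α, -, hallow, hupd, hs⟩ := h
  match α, hallow, hupd, hs with
  | .push n, _, hupd, _ =>
    rw [Fin.le_def, hupd.2 d]
    -- The reset by a push hits `c_d` only if the depth is `d - 1`, which `hd` excludes.
    split_ifs <;> omega
  | .pop, _, hupd, _ => rw [hupd.2]
  | .apply a none, _, hupd, _ => rw [show c'.2 = c.2 from hupd]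
  | .apply a (some k), hallow, hupd, ⟨e, he, hs⟩ =>
    have hk : φ.num k P c'.1 < φ.num k P c.1 := hs ▸ (he.2.2.2.2.2 k).1 hallow.2.1
    -- A charge at level at most `d` would decrease one of the `d` bottom variables. Levels start at
    -- `1`, indices at `0`.
    have hlt : ¬ c.2.stack.idxOf k + 1 ≤ (d : ℕ) := fun hle => by
      refine hk.ne (hnum k ?_)
      have hlen : c.2.stack.idxOf k < c.2.stack.length := by omega
      rw [List.mem_take_iff_getElem]
      exact ⟨c.2.stack.idxOf k, by omega, List.getElem_idxOf hlen⟩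
    rw [hupd.2 d, if_neg hlt]

/-- If the depth of the stack is `d` and stays at least `d`, and neither the counter `c_d` nor any
variable on the stack changes, then the step applies an abstract action without decrements. -/
theorem PlusStep.exists_apply_none {c c' : P.State × Memory N K} (h : PlusStep φ P π c c')
    (d : Fin (Fintype.card N + 1)) (hd : c.2.stack.length = d) (hd' : (d : ℕ) ≤ c'.2.stack.length)
    (hcount : c'.2.count d = c.2.count d)
    (hnum : ∀ n ∈ c.2.stack, φ.num n P c'.1 = φ.num n P c.1) :
    ∃ a, π (configAbs φ P c) = some (.apply a none) ∧ (∀ n, a.effN n ≠ some .dec) ∧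
      c'.2 = c.2 := by
  obtain ⟨α, hα, hallow, hupd, hs⟩ := h
  match α, hα, hallow, hupd, hs with
  | .push n, _, _, hupd, _ =>
    have := hupd.2 d
    rw [if_pos hd.symm, hcount] at this
    omega
  | .pop, _, hallow, hupd, _ =>
    have := List.length_pos_of_ne_nil hallow
    rw [hupd.1, List.length_dropLast] at hd'
    omega
  | .apply a none, hα, hallow, hupd, _ => exact ⟨a, hα, hallow.2, hupd⟩
  | .apply a (some k), _, hallow, _, ⟨e, he, hs⟩ =>
    have hk : φ.num k P c'.1 < φ.num k P c.1 := hs ▸ (he.2.2.2.2.2 k).1 hallow.2.1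
    exact absurd (hnum k hallow.2.2) hk.ne

/-- A step of `Q⁺_F` that applies an abstract action without decrements is deterministic. -/
theorem QNP.plus_step_unique {x y z : AbsState B N × Memory N K} {a : AbsAction B N}
    (hx : π x = some (.apply a none)) (ha : ∀ n, a.effN n ≠ some .dec)
    (hy : (Q.plus K).Step π x y) (hz : (Q.plus K).Step π x z) : y = z := by
  obtain ⟨-, α, hα, -, hy1, hy2⟩ := hy
  obtain ⟨-, β, hβ, -, hz1, hz2⟩ := hz
  obtain rfl : α = .apply a none := Option.some.inj (hα.symm.trans hx)
  obtain rfl : β = .apply a none := Option.some.inj (hβ.symm.trans hx)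
  exact Prod.ext (QNP.outcomes_unique ha hy2 hz2)
    ((show y.2 = x.2 from hy1).trans (show z.2 = x.2 from hz1).symm)

/-! ### Termination -/

/-- In an infinite execution, from some point on, only abstract actions without decrements are
applied. -/
theorem eventually_apply_none (t : ℕ → P.State × Memory N K)
    (ht : ∀ i, PlusStep φ P π (t i) (t (i + 1))) :
    ∀ᶠ i in Filter.atTop, ∃ a, π (configAbs φ P (t i)) = some (.apply a none) ∧
      ∀ n, a.effN n ≠ some .dec := by
  have := P.finite_var
  have := P.finite_val
  obtain ⟨d, hge, hfreq⟩ := exists_liminf_nat (fun i => (t i).2.stack.length) (Fintype.card N)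
    fun i => (t i).2.length_le
  have hdcard : d < Fintype.card N + 1 := by
    obtain ⟨i, hi⟩ := hge.exists
    have := (t i).2.length_le
    omega
  obtain ⟨T, hT⟩ := Filter.eventually_atTop.1 hge
  have htake : ∀ i, T ≤ i → (t i).2.stack.take d = (t T).2.stack.take d := by
    intro i hi
    induction i, hi using Nat.le_induction with
    | base => rfl
    | succ i hi ih => rw [← ih, (ht i).take_stack (hT i hi) (hT (i + 1) (by omega))]
  have hnum : ∀ᶠ i in Filter.atTop, ∀ n ∈ (t T).2.stack.take d,
      φ.num n P (t (i + 1)).1 = φ.num n P (t i).1 := by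
    refine Filter.eventually_all.2 fun n => ?_
    by_cases hn : n ∈ (t T).2.stack.take d
    · have hfin : (Set.range fun i => φ.num n P (t i).1).Finite :=
        (Set.finite_range (φ.num n P)).subset (Set.range_subset_iff.2 fun i => ⟨_, rfl⟩)
      refine (eventually_succ_eq_of_finite_range _ hfin ?_).mono fun i hi _ => hi
      refine Filter.eventually_atTop.2 ⟨T, fun i hi => (ht i).num_le ?_⟩
      exact List.mem_of_mem_take (htake i hi ▸ hn)
    · exact Filter.Eventually.of_forall fun i h => absurd h hn
  have hcount : ∀ᶠ i in Filter.atTop,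
      (t (i + 1)).2.count ⟨d, hdcard⟩ = (t i).2.count ⟨d, hdcard⟩ := by
    -- In the dual order, the nondecreasing counter becomes nonincreasing.
    refine (eventually_succ_eq_of_finite_range
      (fun i => OrderDual.toDual ((t i).2.count ⟨d, hdcard⟩)) (Set.toFinite _) ?_)
    filter_upwards [hnum, Filter.eventually_ge_atTop T] with i hi hTi
    exact (ht i).count_le ⟨d, hdcard⟩ (hT i hTi) (htake i hTi ▸ hi)
  obtain ⟨T', hT'⟩ := Filter.eventually_atTop.1
    ((hnum.and hcount).and (Filter.eventually_ge_atTop T))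
  -- A time of depth exactly `d` after everything has become constant.
  obtain ⟨k, hk, hkd⟩ := Filter.frequently_atTop.1 hfreq T'
  have happ : ∀ i, k ≤ i → (t i).2.stack.length = d →
      ∃ a, π (configAbs φ P (t i)) = some (.apply a none) ∧ (∀ n, a.effN n ≠ some .dec) ∧
        (t (i + 1)).2 = (t i).2 := by
    intro i hi hd
    obtain ⟨⟨h1, h2⟩, h3⟩ := hT' i (by omega)
    refine (ht i).exists_apply_none ⟨d, hdcard⟩ hd (hT (i + 1) (by omega)) h2 ?_
    -- At depth `d`, the `d` bottom variables are the whole stack.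
    rwa [← htake i h3, ← hd, List.take_length] at h1
  have hlen : ∀ i, k ≤ i → (t i).2.stack.length = d := by
    intro i hi
    induction i, hi using Nat.le_induction with
    | base => exact hkd
    | succ i hi ih =>
      obtain ⟨a, -, -, h⟩ := happ i hi ih
      rw [h, ih]
  refine Filter.eventually_atTop.2 ⟨k, fun i hi => ?_⟩
  obtain ⟨a, h1, h2, -⟩ := happ i hi (hlen i hi)
  exact ⟨a, h1, h2⟩

/-- There is no infinite execution through live configurations. -/
theorem not_forall_live (hA : ∀ a ∈ Q.actions, a.Guarded) (hπ : (Q.plus K).Solves π)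
    (t : ℕ → P.State × Memory N K) (ht : ∀ i, PlusStep φ P π (t i) (t (i + 1))) :
    ¬ ∀ i, Live φ P Q π (t i) := by
  intro hlive
  obtain ⟨T, hT⟩ := Filter.eventually_atTop.1 (eventually_apply_none t ht)
  obtain ⟨y, hy, hpath⟩ := hπ _ (hlive T).2.1
  -- By determinism, every path of `Q⁺_F` from time `T` on runs along `t`.
  have hmem : ∃ i, T ≤ i ∧ y = configAbs φ P (t i) := by
    clear hy
    induction hpath with
    | refl => exact ⟨T, le_rfl, rfl⟩
    | tail _ hstep ih =>
      obtain ⟨i, hi, rfl⟩ := ih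
      obtain ⟨a, ha, hdec⟩ := hT i hi
      exact ⟨i + 1, by omega,
        QNP.plus_step_unique ha hdec hstep ((ht i).toFOND hA hπ (hlive i))⟩
  obtain ⟨i, -, rfl⟩ := hmem
  exact (hlive i).2.2 hy

/-- The steps between live configurations form a well-founded relation. -/
theorem wellFounded_live (hA : ∀ a ∈ Q.actions, a.Guarded) (hπ : (Q.plus K).Solves π) :
    WellFounded fun c' c : P.State × Memory N K =>
      PlusStep φ P π c c' ∧ Live φ P Q π c ∧ Live φ P Q π c' := by
  rw [wellFounded_iff_isEmpty_descending_chain]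
  exact ⟨fun ⟨t, ht⟩ => not_forall_live hA hπ t (fun i => (ht i).1) fun i => (ht i).2.1⟩

theorem live_init
    (hG : ∀ s : P.State, P.Reachable s → (φ.abs P s).Sat Q.goal → P.IsGoal s)
    (hI : (φ.abs P P.init).Sat Q.init) (h : ¬ P.IsGoal P.init) :
    Live φ P Q π (P.init, Memory.empty N K) :=
  ⟨.refl, ⟨configAbs φ P (P.init, Memory.empty N K), ⟨hI, rfl⟩, .refl⟩,
    fun hg => h (hG _ .refl hg)⟩

theorem plusSolves_of_solves (hA : ∀ a ∈ Q.actions, a.Guarded) (hπ : (Q.plus K).Solves π)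
    (hsound : ∀ s : P.State, P.Reachable s → ∀ a ∈ Q.actions, a.Applicable (φ.abs P s) →
      ∃ e : P.Act, Instantiates φ P s e a)
    (hG : ∀ s : P.State, P.Reachable s → (φ.abs P s).Sat Q.goal → P.IsGoal s)
    (hI : (φ.abs P P.init).Sat Q.init) : PlusSolves φ P π := by
  have hinit := live_init (K := K) (π := π) hG hI
  constructor
  · intro t h0 ht
    by_contra! hno
    refine not_forall_live hA hπ t ht fun i => ?_
    induction i with
    | zero => exact h0 ▸ hinit (by simpa [h0] using hno 0)
    | succ i ih => exact ih.step hA hπ hG (ht i) (hno _)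
  · intro k t h0 ht hmax
    by_contra! hno
    have hlive : ∀ i ≤ k, Live φ P Q π (t i) := by
      intro i
      induction i with
      | zero => exact fun _ => h0 ▸ hinit (by simpa [h0] using hno 0 (Nat.zero_le _))
      | succ i ih => exact fun hi => (ih (by omega)).step hA hπ hG (ht i (by omega)) (hno _ hi)
    obtain ⟨c, hc⟩ := (hlive k le_rfl).exists_plusStep hπ hsound
    exact hmax c hc

/-! ### Memoryless policies -/

/-- From a live configuration, the policy gets to the application of an abstract action by pushes
and pops. -/
theorem Live.exists_apply (hA : ∀ a ∈ Q.actions, a.Guarded) (hπ : (Q.plus K).Solves π)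
    (hsound : ∀ s : P.State, P.Reachable s → ∀ a ∈ Q.actions, a.Applicable (φ.abs P s) →
      ∃ e : P.Act, Instantiates φ P s e a)
    {c : P.State × Memory N K} (hc : Live φ P Q π c) :
    ∃ c', c'.1 = c.1 ∧ Live φ P Q π c' ∧
      Relation.ReflTransGen
        (fun c c' => PlusStep φ P π c c' ∧ Live φ P Q π c ∧ Live φ P Q π c') c c' ∧
      ∃ a k, π (configAbs φ P c') = some (.apply a k) := by
  induction c using (wellFounded_live (φ := φ) (P := P) hA hπ).induction with
  | _ c ih =>
    obtain ⟨c', h⟩ := hc.exists_plusStep hπ hsound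
    by_cases happ : ∃ a k, π (configAbs φ P c) = some (.apply a k)
    · exact ⟨c, rfl, hc, .refl, happ⟩
    · have heq : c'.1 = c.1 := by
        obtain ⟨α, hα, -, -, hs⟩ := h
        cases α with
        | push n => exact hs
        | pop => exact hs
        | apply a k => exact absurd ⟨a, k, hα⟩ happ
      -- Pushes and pops keep the abstract state, so they cannot enter the goal of `Q⁺_F`.
      have hc' : Live φ P Q π c' := by
        refine ⟨h.reachable hc.1, hc.2.1.step (h.toFOND hA hπ hc), fun hg => hc.2.2 ?_⟩
        change (φ.abs P c.1).Sat Q.goal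
        rw [← heq]
        exact hg
      obtain ⟨c'', h1, h2, h3, h4⟩ := ih c' ⟨h, hc, hc'⟩ hc'
      exact ⟨c'', h1.trans heq, h2, .head ⟨h, hc, hc'⟩ h3, h4⟩

/-- The invariant is that some live configuration of `π` lies over the current state. Its memory
serves the proof only, as `ρ` does not read it. -/
theorem policySolves_of_projects (hA : ∀ a ∈ Q.actions, a.Guarded) (hπ : (Q.plus K).Solves π)
    (hsound : ∀ s : P.State, P.Reachable s → ∀ a ∈ Q.actions, a.Applicable (φ.abs P s) →
      ∃ e : P.Act, Instantiates φ P s e a)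
    (hG : ∀ s : P.State, P.Reachable s → (φ.abs P s).Sat Q.goal → P.IsGoal s)
    (hI : (φ.abs P P.init).Sat Q.init) (ρ : AbsState B N → Option (AbsAction B N))
    (hρ : Q.Projects π ρ) : PolicySolves φ P ρ := by
  have hinit := live_init (K := K) (π := π) hG hI
  let R := fun c c' => PlusStep φ P π c c' ∧ Live φ P Q π c ∧ Live φ P Q π c'
  have hstep : ∀ c, Live φ P Q π c → ∀ s', PolicyStep φ P ρ c.1 s' → ¬ P.IsGoal s' →
      ∃ c', c'.1 = s' ∧ Live φ P Q π c' ∧ Relation.TransGen R c c' := by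
    rintro c hc s' ⟨a, e, ha, he, rfl⟩ hs'
    obtain ⟨c₁, h1, h2, h3, a', k, h4⟩ := hc.exists_apply hA hπ hsound
    obtain rfl : a = a' := by
      have := hρ _ h2.2.1 h2.2.2 a' k h4
      rw [← h1] at ha
      exact Option.some.inj (ha.symm.trans this)
    -- Only the memory of `y` is used; the state is the one that `e`, the action chosen by `ρ`'s
    -- execution, produces.
    obtain ⟨y, -, α, hα, happ, hupd, -⟩ := hπ.exists_step h2.2.1 h2.2.2
    obtain rfl : α = .apply a k := Option.some.inj (hα.symm.trans h4)
    have hp : PlusStep φ P π c₁ (P.next e c.1, y.2) :=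
      ⟨_, h4, happ.1, hupd, e, by rwa [h1], by rw [h1]⟩
    have hl := h2.step hA hπ hG hp hs'
    exact ⟨_, rfl, hl, .tail' h3 ⟨hp, h2, hl⟩⟩
  constructor
  · intro t h0 ht
    by_contra! hno
    have key : ∀ c : P.State × Memory N K, Live φ P Q π c → ∀ i, c.1 ≠ t i := by
      intro c
      -- One step of `ρ` is at least one step of `π`, hence a descent in the transitive closure.
      induction c using (wellFounded_live (φ := φ) (P := P) hA hπ).transGen.induction with
      | _ c ih =>
        intro hc i hi
        obtain ⟨c', h1, h2, h3⟩ := hstep c hc (t (i + 1)) (hi ▸ ht i) (hno _)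
        exact ih c' (Relation.transGen_swap.2 h3) h2 (i + 1) h1
    exact key _ (hinit (h0 ▸ hno 0)) 0 h0.symm
  · intro k t h0 ht hmax
    by_contra! hno
    have hlive : ∀ i ≤ k, ∃ c, c.1 = t i ∧ Live φ P Q π c := by
      intro i
      induction i with
      | zero => exact fun _ => ⟨_, h0.symm, hinit (h0 ▸ hno 0 (Nat.zero_le _))⟩
      | succ i ih =>
        intro hi
        obtain ⟨c, h1, h2⟩ := ih (by omega)
        obtain ⟨c', h3, h4, -⟩ := hstep c h2 (t (i + 1)) (h1 ▸ ht i (by omega)) (hno _ hi)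
        exact ⟨c', h3, h4⟩
    obtain ⟨c, h1, h2⟩ := hlive k le_rfl
    -- No dead end: over the same state, `π` arrives at an abstract action, which is the choice of
    -- `ρ` and is instantiated by soundness.
    obtain ⟨c₁, h3, h4, -, a, j, h5⟩ := h2.exists_apply hA hπ hsound
    obtain ⟨c₂, α, hα, -, -, hs⟩ := h4.exists_plusStep hπ hsound
    obtain rfl : α = .apply a j := Option.some.inj (hα.symm.trans h5)
    obtain ⟨e, he, -⟩ := hs
    rw [← h1, ← h3] at hmax
    exact hmax _ ⟨a, e, hρ _ h4.2.1 h4.2.2 a j h5, he, rfl⟩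

end Execution

end GenPlan

theorem theorem5 {B : Type v} {N : Type w} [Finite B] [Fintype N] [DecidableEq N]
    (𝓠 : Set GenPlan.Instance.{u}) (φ : GenPlan.Features.{u} B N)
    (S : Set GenPlan.Transition.{u}) (hS : GenPlan.IsSample 𝓠 S)
    (I_F G_F : GenPlan.Formula B N) (A_F : Set (GenPlan.AbsAction B N))
    (hA : ∀ a ∈ A_F, a.Guarded)
    (hsample : GenPlan.SoundOnSample S φ A_F)
    (hsound : GenPlan.Sound 𝓠 φ A_F)
    (K : ℕ) (π : GenPlan.AbsState B N × GenPlan.Memory N K → Option (GenPlan.PlusAction B N))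
    (hπ : ((GenPlan.QNP.mk I_F G_F A_F).plus K).Solves π)
    (P : GenPlan.Instance.{u}) (hP : P ∈ 𝓠)
    (hI : (φ.abs P P.init).Sat I_F)
    (hG : ∀ s : P.State, P.Reachable s → (φ.abs P s).Sat G_F → P.IsGoal s) :
    GenPlan.PlusSolves φ P π ∧
      ∀ ρ : GenPlan.AbsState B N → Option (GenPlan.AbsAction B N),
        (GenPlan.QNP.mk I_F G_F A_F).Projects π ρ → GenPlan.PolicySolves φ P ρ := by

  have hs := hsound P hP
  exact ⟨GenPlan.plusSolves_of_solves (Q := ⟨I_F, G_F, A_F⟩) hA hπ hs hG hI, fun ρ hρ =>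
    GenPlan.policySolves_of_projects (Q := ⟨I_F, G_F, A_F⟩) hA hπ hs hG hI ρ hρ⟩
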